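/- Let $\mathbb{F}$ be a finite field, $\sigma$ an automorphism of $\mathbb{F}$ of order $\mu$, and $R=\mathbb{F}[X;\sigma]$ the skew polynomial ring of left polynomials $\sum_i a_iX^i$ ($a_i\in\mathbb F$) with $Xa=\sigma(a)X$ for $a\in\mathbb{F}$. Let $\mathbb{F}^{\sigma}$ be the subfield of elements fixed by $\sigma$, put $z=X^{\mu}$, and consider the commutative polynomial ring $\mathbb{F}^{\sigma}[z]\subseteq R$. Let $f\in R$ have right greatest common divisor $1$ with $X$ (that is, $Rf+RX=R$). Let $f^*\in R$ be a bound of $f$, i.e. $Rf^*=f^*R$ is the largest two-sided ideal of $R$ contained in $Rf$, and assume that $f^*$ lies in $\mathbb{F}^{\sigma}[z]$ and is irreducible as an element of $\mathbb{F}^{\sigma}[z]$. Then $f$ is a product of irreducible elements of $R$, and for every factorization $f=f_1\cdots f_t$ into irreducible elements of $R$ one has $t\ge 1$ and $$\deg f^*=\frac{\mu\,\deg f}{t},$$ where both degrees are degrees in $X$. In particular, the number $t$ of irreducible factors of $f$ does not depend on the factorization. -/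

import Mathlib

/-- The action of the additive monoid `ℕ` on `F` in which `n` acts as the `n`-th iterate of the
automorphism `σ`. -/
abbrev skewAction {F : Type*} [Field F] (σ : F ≃+* F) :
    MulSemiringAction (Multiplicative ℕ) F :=
  MulSemiringAction.compHom F (powersHom (RingAut F) σ)

/-- The skew polynomial ring `F[X;σ]`: left polynomials `∑ aᵢ Xⁱ`, with `X a = σ(a) X`.
This is Mathlib's `SkewPolynomial F`, multiplied through the action of `σ`. -/
def SkewPoly {F : Type*} [Field F] (_σ : F ≃+* F) : Type _ := SkewPolynomial F

namespace SkewPoly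

/-- The ring structure of `F[X;σ]`. -/
noncomputable instance {F : Type*} [Field F] (σ : F ≃+* F) : Ring (SkewPoly σ) :=
  letI := skewAction σ
  inferInstanceAs (Ring (SkewPolynomial F))

/-- The inclusion of the constants `F → F[X;σ]`. -/
noncomputable def const {F : Type*} [Field F] (σ : F ≃+* F) : F →+* SkewPoly σ :=
  letI := skewAction σ
  (SkewPolynomial.CRingHom : F →+* SkewPolynomial F)

/-- The variable `X` of `F[X;σ]`. -/
noncomputable def var {F : Type*} [Field F] (σ : F ≃+* F) : SkewPoly σ :=
  (SkewPolynomial.X : SkewPolynomial F)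

/-- The degree of a skew polynomial: the largest exponent with a nonzero coefficient
(with the value `0` at the zero polynomial). -/
def deg {F : Type*} [Field F] {σ : F ≃+* F} (f : SkewPoly σ) : ℕ :=
  (SkewPolynomial.support (R := F) f).sup id

/-- The subfield `F^σ` of the elements fixed by `σ`. -/
def fixedField {F : Type*} [Field F] (σ : F ≃+* F) : Subfield F :=
  RingHom.eqLocusField (σ : F →+* F) (RingHom.id F)

/-- The element `∑ cᵢ zⁱ` of `F^σ[z] ⊆ F[X;σ]`, where `z = X ^ μ` and `μ` is the order of `σ`,
given by a commutative polynomial `∑ cᵢ zⁱ` with coefficients in `F^σ`. -/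
noncomputable def ofFixed {F : Type*} [Field F] (σ : F ≃+* F)
    (p : Polynomial (fixedField σ)) : SkewPoly σ :=
  p.eval₂ ((const σ).comp (fixedField σ).subtype) (var σ ^ orderOf (σ : RingAut F))

end SkewPoly

/-- `d` is a right greatest common divisor of `f` and `g`: `R f + R g = R d`. In Mathlib
`Ideal R` is the type of left ideals, and `Ideal.span {f}` is `R f`. -/
def IsRightGCD {R : Type*} [Ring R] (f g d : R) : Prop :=
  Ideal.span {f} ⊔ Ideal.span {g} = Ideal.span {d}

/-- `b` is a bound of `f`: `R b = b R` is the largest two-sided ideal contained in `R f`. -/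
def IsBound {R : Type*} [Ring R] (f b : R) : Prop :=
  (Set.range (fun r : R => r * b) = Set.range (fun r : R => b * r)) ∧
    IsGreatest {I : Ideal R | I.IsTwoSided ∧ I ≤ Ideal.span {f}} (Ideal.span {b})

/-- `l = [f₁, …, f_t]` is a factorization `f = f₁ ⋯ f_t` into irreducible elements. -/
def IsIrreducibleFactorization {R : Type*} [Ring R] (f : R) (l : List R) : Prop :=
  l.prod = f ∧ ∀ p ∈ l, Irreducible p

/-! Write `f* = p` with `p` irreducible in `F^σ[z]`. Every irreducible factor of `f` turns out to
have degree `d = deg_z p`, so `deg f = t d`, while `deg f* = μ d`.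

Coprimality of `f` and `X` forces `p(0) ≠ 0`: otherwise `p` is an associate of `z`, and `f` would
divide a power of `X`. Since `p` is central, each irreducible factor `q` of `f` divides `p` on the
right (`ofFixed_mem_span_of_mem_span_mul`). The module `M = R/Rq` is finite and simple. Its
annihilator is `Rp`, because `Rp` is a maximal two-sided ideal (`eq_span_ofFixed_of_isTwoSided`),
and its endomorphism ring `E` is the field `F^σ[z]/(p)` (`natCard_moduleEnd_quotient_span`).

By density `R/Rp ≅ End_E(M)`, so `|M| = |E|^n` gives `|R/Rp| = |M|^n`. With `|F| = |F^σ|^μ` these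
become `μ deg q = d n` and `μ d = n deg q`, whence `deg q = d`. -/

namespace SkewPoly

/-! ### Coefficients and the twisted product. -/

section Coeff

variable {F : Type*} [Field F] {σ : F ≃+* F}

/-- The coefficient of `X ^ n` in a skew polynomial. -/
def coeff (f : SkewPoly σ) (n : ℕ) : F := SkewPolynomial.coeff (R := F) f n

theorem ext_coeff {f g : SkewPoly σ} (h : ∀ n, f.coeff n = g.coeff n) : f = g :=
  SkewPolynomial.ext (R := F) h

@[simp] theorem coeff_zero (n : ℕ) : (0 : SkewPoly σ).coeff n = 0 := rfl

@[simp] theorem coeff_add (f g : SkewPoly σ) (n : ℕ) :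
    (f + g).coeff n = f.coeff n + g.coeff n :=
  SkewPolynomial.coeff_add (R := F) f g n

@[simp] theorem coeff_neg (f : SkewPoly σ) (n : ℕ) : (-f).coeff n = -f.coeff n :=
  SkewPolynomial.coeff_neg (R := F) f n

@[simp] theorem coeff_sub (f g : SkewPoly σ) (n : ℕ) :
    (f - g).coeff n = f.coeff n - g.coeff n :=
  SkewPolynomial.coeff_sub (R := F) f g n

/-- Taking the `n`-th coefficient, as an additive homomorphism. -/
def coeffHom (σ : F ≃+* F) (n : ℕ) : SkewPoly σ →+ F where
  toFun f := f.coeff n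
  map_zero' := rfl
  map_add' f g := coeff_add f g n

theorem coeff_sum {ι : Type*} (s : Finset ι) (f : ι → SkewPoly σ) (n : ℕ) :
    (∑ i ∈ s, f i).coeff n = ∑ i ∈ s, (f i).coeff n :=
  map_sum (coeffHom σ n) f s

theorem coeff_mul (f g : SkewPoly σ) (n : ℕ) :
    (f * g).coeff n =
      ∑ p ∈ Finset.HasAntidiagonal.antidiagonal n, f.coeff p.1 * (σ ^ p.1) (g.coeff p.2) := by
  let := skewAction σ
  have h := SkewMonoidAlgebra.coeff_mul_antidiagonal_of_finset (k := F) f g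
    (Multiplicative.ofAdd n)
    ((Finset.HasAntidiagonal.antidiagonal n).map
      ((Multiplicative.ofAdd (α := ℕ)).toEmbedding.prodMap
        (Multiplicative.ofAdd (α := ℕ)).toEmbedding))
    (by
      rintro ⟨a, b⟩
      constructor
      · intro h
        obtain ⟨x, hx, hx'⟩ := Finset.mem_map.1 h
        rw [← hx']
        exact congrArg Multiplicative.ofAdd (Finset.HasAntidiagonal.mem_antidiagonal.1 hx)
      · intro h
        exact Finset.mem_map.2 ⟨(a.toAdd, b.toAdd),
          Finset.HasAntidiagonal.mem_antidiagonal.2 (congrArg Multiplicative.toAdd h), rfl⟩)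
  rw [Finset.sum_map] at h
  exact h

theorem coeff_const (a : F) (n : ℕ) : (const σ a).coeff n = if n = 0 then a else 0 :=
  SkewPolynomial.coeff_C (R := F) (a := a) (n := n)

theorem coeff_var (n : ℕ) : (var σ).coeff n = if 1 = n then 1 else 0 :=
  SkewPolynomial.coeff_X (R := F)

theorem coeff_one (n : ℕ) : (1 : SkewPoly σ).coeff n = if n = 0 then 1 else 0 := by
  rw [← map_one (const σ), coeff_const]

@[simp] theorem coeff_const_mul (a : F) (f : SkewPoly σ) (n : ℕ) :
    (const σ a * f).coeff n = a * f.coeff n := by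
  rw [coeff_mul, Finset.sum_eq_single (0, n)]
  · simp [coeff_const]
  · rintro ⟨i, j⟩ hij hne
    have : i ≠ 0 := by
      rintro rfl
      simp at hij
      simp [hij] at hne
    simp [coeff_const, this]
  · simp

@[simp] theorem coeff_mul_const (a : F) (f : SkewPoly σ) (n : ℕ) :
    (f * const σ a).coeff n = f.coeff n * (σ ^ n) a := by
  rw [coeff_mul, Finset.sum_eq_single (n, 0)]
  · simp [coeff_const]
  · rintro ⟨i, j⟩ hij hne
    have : j ≠ 0 := by
      rintro rfl
      simp at hij
      simp [hij] at hne
    simp [coeff_const, this]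
  · simp

@[simp] theorem coeff_var_mul_succ (f : SkewPoly σ) (n : ℕ) :
    (var σ * f).coeff (n + 1) = σ (f.coeff n) := by
  rw [coeff_mul, Finset.sum_eq_single (1, n)]
  · simp [coeff_var]
  · rintro ⟨i, j⟩ hij hne
    have : 1 ≠ i := by
      rintro rfl
      have : j = n := by simp at hij; omega
      simp [this] at hne
    simp [coeff_var, this]
  · simp [add_comm]

@[simp] theorem coeff_var_mul_zero (f : SkewPoly σ) : (var σ * f).coeff 0 = 0 := by
  simp [coeff_mul, coeff_var]

@[simp] theorem coeff_mul_var_succ (f : SkewPoly σ) (n : ℕ) :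
    (f * var σ).coeff (n + 1) = f.coeff n := by
  rw [coeff_mul, Finset.sum_eq_single (n, 1)]
  · simp [coeff_var]
  · rintro ⟨i, j⟩ hij hne
    have : 1 ≠ j := by
      rintro rfl
      have : i = n := by simp at hij; omega
      simp [this] at hne
    simp [coeff_var, this]
  · simp

@[simp] theorem coeff_mul_var_zero (f : SkewPoly σ) : (f * var σ).coeff 0 = 0 := by
  simp [coeff_mul, coeff_var]

theorem coeff_mul_zero (f g : SkewPoly σ) : (f * g).coeff 0 = f.coeff 0 * g.coeff 0 := by
  simp [coeff_mul]

theorem coeff_var_pow (m n : ℕ) : (var σ ^ m).coeff n = if n = m then 1 else 0 := by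
  induction m generalizing n with
  | zero => rw [pow_zero, coeff_one]
  | succ m ih => cases n <;> simp [pow_succ, ih]

instance : Nontrivial (SkewPoly σ) :=
  ⟨⟨0, 1, fun h ↦ by simpa [coeff_one] using congrArg (coeff · 0) h⟩⟩

theorem var_mul_const (a : F) : var σ * const σ a = const σ (σ a) * var σ := by
  refine ext_coeff fun n ↦ ?_
  rw [coeff_const_mul, coeff_mul_const, coeff_var]
  split_ifs with h
  · subst h; simp
  · simp

theorem const_ne_zero {a : F} (ha : a ≠ 0) : const σ a ≠ 0 :=
  (map_ne_zero_iff _ (const σ).injective).2 ha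

theorem var_ne_zero : var σ ≠ 0 := fun h ↦ by
  simpa [coeff_var] using congrArg (coeff · 1) h

end Coeff

/-! ### Degree, right division and cyclic modules `R/Rg`. -/

section Degree

variable {F : Type*} [Field F] {σ : F ≃+* F}

theorem coeff_eq_zero_of_deg_lt {f : SkewPoly σ} {n : ℕ} (h : f.deg < n) : f.coeff n = 0 := by
  by_contra hn
  have hm : n ∈ SkewPolynomial.support (R := F) f := SkewPolynomial.mem_support_iff.2 hn
  exact absurd (Finset.le_sup (f := id) hm) (not_le.2 h)

theorem deg_le_of_coeff_eq_zero {f : SkewPoly σ} {n : ℕ} (h : ∀ k, n < k → f.coeff k = 0) :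
    f.deg ≤ n := by
  refine Finset.sup_le fun k hk ↦ ?_
  by_contra hlt
  exact SkewPolynomial.mem_support_iff.1 hk (h k (not_le.1 hlt))

theorem le_deg_of_coeff_ne_zero {f : SkewPoly σ} {n : ℕ} (h : f.coeff n ≠ 0) : n ≤ f.deg := by
  by_contra hlt
  exact h (coeff_eq_zero_of_deg_lt (not_le.1 hlt))

theorem coeff_deg_ne_zero {f : SkewPoly σ} (hf : f ≠ 0) : f.coeff f.deg ≠ 0 := by
  have hs : (SkewPolynomial.support (R := F) f).Nonempty := by
    rw [Finset.nonempty_iff_ne_empty]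
    exact fun h ↦ hf (SkewPolynomial.support_eq_empty.1 h)
  obtain ⟨n, hn, hn'⟩ := Finset.exists_mem_eq_sup _ hs id
  have : f.deg = n := hn'
  rw [this]
  exact SkewPolynomial.mem_support_iff.1 hn

theorem deg_lt_of_coeff_eq_zero {f : SkewPoly σ} {n : ℕ} (hf : f ≠ 0)
    (h : ∀ k, n ≤ k → f.coeff k = 0) : f.deg < n := by
  by_contra hlt
  exact coeff_deg_ne_zero hf (h _ (not_lt.1 hlt))

theorem coeff_mul_add_of_le {f g : SkewPoly σ} {m n : ℕ} (hf : f.deg ≤ m) (hg : g.deg ≤ n) :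
    (f * g).coeff (m + n) = f.coeff m * (σ ^ m) (g.coeff n) := by
  rw [coeff_mul, Finset.sum_eq_single (m, n)]
  · rintro ⟨i, j⟩ hij hne
    rw [Finset.HasAntidiagonal.mem_antidiagonal] at hij
    rcases lt_trichotomy i m with h | h | h
    · rw [coeff_eq_zero_of_deg_lt (f := g) (n := j) (by simp only at hij; omega)]
      simp
    · exfalso
      apply hne
      ext <;> simp only at hij ⊢ <;> omega
    · rw [coeff_eq_zero_of_deg_lt (f := f) (n := i) (by omega)]
      simp
  · simp

theorem coeff_mul_eq_zero {f g : SkewPoly σ} {k : ℕ} (h : f.deg + g.deg < k) :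
    (f * g).coeff k = 0 := by
  rw [coeff_mul]
  refine Finset.sum_eq_zero ?_
  rintro ⟨i, j⟩ hij
  rw [Finset.HasAntidiagonal.mem_antidiagonal] at hij
  simp only at hij
  rcases lt_or_ge f.deg i with h' | h'
  · simp [coeff_eq_zero_of_deg_lt h']
  · simp [coeff_eq_zero_of_deg_lt (f := g) (n := j) (by omega)]

/-- The leading coefficient of `f` multiplies a twist of that of `g`, and powers of `σ` are
injective. -/
theorem coeff_mul_deg_ne_zero {f g : SkewPoly σ} (hf : f ≠ 0) (hg : g ≠ 0) :
    (f * g).coeff (f.deg + g.deg) ≠ 0 := by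
  rw [coeff_mul_add_of_le le_rfl le_rfl]
  exact mul_ne_zero (coeff_deg_ne_zero hf)
    ((map_ne_zero_iff _ (σ ^ f.deg).injective).2 (coeff_deg_ne_zero hg))

instance : NoZeroDivisors (SkewPoly σ) where
  eq_zero_or_eq_zero_of_mul_eq_zero {f g} h := by
    by_contra! hfg
    exact coeff_mul_deg_ne_zero hfg.1 hfg.2 (by rw [h, coeff_zero])

instance : IsDomain (SkewPoly σ) := NoZeroDivisors.to_isDomain _

theorem deg_mul {f g : SkewPoly σ} (hf : f ≠ 0) (hg : g ≠ 0) :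
    (f * g).deg = f.deg + g.deg :=
  le_antisymm (deg_le_of_coeff_eq_zero fun _ ↦ coeff_mul_eq_zero)
    (le_deg_of_coeff_ne_zero (coeff_mul_deg_ne_zero hf hg))

theorem deg_zero : (0 : SkewPoly σ).deg = 0 :=
  Nat.le_zero.1 (deg_le_of_coeff_eq_zero fun _ _ ↦ rfl)

theorem deg_const (a : F) : (const σ a).deg = 0 :=
  Nat.le_zero.1 (deg_le_of_coeff_eq_zero fun k hk ↦ by rw [coeff_const, if_neg (by omega)])

theorem deg_one : (1 : SkewPoly σ).deg = 0 := by
  rw [← map_one (const σ), deg_const]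

theorem eq_const_of_deg_eq_zero {f : SkewPoly σ} (h : f.deg = 0) : f = const σ (f.coeff 0) :=
  ext_coeff fun n ↦ by
    rw [coeff_const]
    split_ifs with hn
    · rw [hn]
    · exact coeff_eq_zero_of_deg_lt (by omega)

theorem isUnit_iff_deg_eq_zero {f : SkewPoly σ} (hf : f ≠ 0) : IsUnit f ↔ f.deg = 0 := by
  constructor
  · intro h
    obtain ⟨g, hg⟩ := h.exists_right_inv
    have hg0 : g ≠ 0 := by rintro rfl; simp at hg
    have := deg_mul hf hg0
    rw [hg, deg_one] at this
    omega
  · intro h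
    have h0 := coeff_deg_ne_zero hf
    rw [h] at h0
    rw [eq_const_of_deg_eq_zero h]
    exact (IsUnit.mk0 _ h0).map (const σ)

/-- Right division with remainder in `F[X;σ]`. -/
theorem exists_eq_mul_add {g : SkewPoly σ} (hg : g ≠ 0) (a : SkewPoly σ) :
    ∃ q r : SkewPoly σ, a = q * g + r ∧ ∀ k, g.deg ≤ k → r.coeff k = 0 := by
  -- Since `deg 0 = 0`, smallness of the remainder is phrased through vanishing coefficients, which
  -- also covers `r = 0` when `g` is constant.
  suffices H : ∀ (n : ℕ) (a : SkewPoly σ), (∀ k, n ≤ k → a.coeff k = 0) →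
      ∃ q r : SkewPoly σ, a = q * g + r ∧ ∀ k, g.deg ≤ k → r.coeff k = 0 from
    H (a.deg + 1) a fun k hk ↦ coeff_eq_zero_of_deg_lt hk
  intro n
  induction n with
  | zero => exact fun a ha ↦ ⟨0, 0, ext_coeff fun k ↦ by simp [ha k k.zero_le], by simp⟩
  | succ n ih =>
    intro a ha
    rcases lt_or_ge n g.deg with h | h
    · exact ⟨0, a, by simp, fun k hk ↦ ha k (by omega)⟩
    obtain ⟨m, rfl⟩ := Nat.exists_eq_add_of_le' h
    -- `u` is the leading coefficient of `X^m g`, so subtracting `c g` kills the top coefficient of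
    -- `a`.
    set u : F := (σ ^ m) (g.coeff g.deg) with hu
    have hu0 : u ≠ 0 := (map_ne_zero_iff _ (σ ^ m).injective).2 (coeff_deg_ne_zero hg)
    set c : SkewPoly σ := const σ (a.coeff (m + g.deg) / u) * var σ ^ m with hc
    have hcm : c.deg ≤ m := deg_le_of_coeff_eq_zero fun k hk ↦ by
      simp [hc, coeff_var_pow, hk.ne']
    obtain ⟨q, r, hqr, hr⟩ := ih (a - c * g) (fun k hk ↦ by
      rw [coeff_sub]
      rcases hk.eq_or_lt with rfl | hk'
      · rw [coeff_mul_add_of_le hcm le_rfl, ← hu]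
        simp [hc, coeff_var_pow, hu0]
      · rw [ha k hk', coeff_mul_eq_zero (by omega), sub_zero])
    exact ⟨c + q, r, by rw [add_mul, add_assoc, ← hqr]; abel, hr⟩

theorem eq_zero_of_mem_span_of_coeff_eq_zero {g r : SkewPoly σ} (hr : r ∈ Ideal.span {g})
    (h : ∀ k, g.deg ≤ k → r.coeff k = 0) : r = 0 := by
  obtain ⟨q, rfl⟩ := Ideal.mem_span_singleton'.1 hr
  by_contra hne
  have h1 := deg_lt_of_coeff_eq_zero hne h
  rw [deg_mul (left_ne_zero_of_mul hne) (right_ne_zero_of_mul hne)] at h1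
  omega

/-- Every nonzero left ideal of `F[X;σ]` is generated by any of its nonzero elements of least
degree. -/
theorem eq_span_of_deg_le {I : Ideal (SkewPoly σ)} {g : SkewPoly σ} (hg : g ∈ I) (hg0 : g ≠ 0)
    (hmin : ∀ h ∈ I, h ≠ 0 → g.deg ≤ h.deg) : I = Ideal.span {g} := by
  refine le_antisymm (fun a ha ↦ ?_) (by rwa [Ideal.span_singleton_le_iff_mem])
  obtain ⟨q, r, rfl, hr⟩ := exists_eq_mul_add hg0 a
  have hrI : r ∈ I := by
    have := I.sub_mem ha (I.mul_mem_left q hg)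
    rwa [add_sub_cancel_left] at this
  have hr0 : r = 0 := by
    by_contra hne
    exact absurd (hmin r hrI hne) (not_le.2 (deg_lt_of_coeff_eq_zero hne hr))
  rw [hr0, add_zero]
  exact Ideal.mem_span_singleton'.2 ⟨q, rfl⟩

theorem exists_min_deg {I : Ideal (SkewPoly σ)} (hI : I ≠ ⊥) :
    ∃ g ∈ I, g ≠ 0 ∧ ∀ h ∈ I, h ≠ 0 → g.deg ≤ h.deg := by
  obtain ⟨x, hx, hx0⟩ := Submodule.exists_mem_ne_zero_of_ne_bot hI
  obtain ⟨g, ⟨hg, hg0⟩, hmin⟩ := (measure (α := SkewPoly σ) deg).wf.has_min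
    {g | g ∈ I ∧ g ≠ 0} ⟨x, hx, hx0⟩
  exact ⟨g, hg, hg0, fun h hh hh0 ↦ not_lt.1 (hmin h ⟨hh, hh0⟩)⟩

/-- `F[X;σ]` is a left principal ideal ring. -/
theorem exists_eq_span (I : Ideal (SkewPoly σ)) : ∃ g, I = Ideal.span {g} := by
  by_cases hI : I = ⊥
  · exact ⟨0, by rw [hI, Ideal.span_singleton_eq_bot.2 rfl]⟩
  · obtain ⟨g, hg, hg0, hmin⟩ := exists_min_deg hI
    exact ⟨g, eq_span_of_deg_le hg hg0 hmin⟩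

/-- A nonzero nonunit of `F[X;σ]` is a product of irreducible elements. -/
theorem exists_irreducible_factorization {f : SkewPoly σ} (hf : f ≠ 0) (hu : ¬ IsUnit f) :
    ∃ l, IsIrreducibleFactorization f l := by
  induction hn : f.deg using Nat.strong_induction_on generalizing f with
  | _ n ih =>
    subst hn
    by_cases hirr : Irreducible f
    · exact ⟨[f], by simp, by simpa⟩
    · rw [irreducible_iff] at hirr
      push Not at hirr
      obtain ⟨a, b, rfl, ha, hb⟩ := hirr hu
      have ha0 := left_ne_zero_of_mul hf
      have hb0 := right_ne_zero_of_mul hf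
      have hda := mt (isUnit_iff_deg_eq_zero ha0).2 ha
      have hdb := mt (isUnit_iff_deg_eq_zero hb0).2 hb
      have hd := deg_mul ha0 hb0
      obtain ⟨l, hl, hl'⟩ := ih a.deg (by omega) ha0 ha rfl
      obtain ⟨m, hm, hm'⟩ := ih b.deg (by omega) hb0 hb rfl
      refine ⟨l ++ m, by rw [List.prod_append, hl, hm], fun p hp ↦ ?_⟩
      rcases List.mem_append.1 hp with h | h
      · exact hl' p h
      · exact hm' p h

theorem isUnit_of_span_eq_top {g : SkewPoly σ} (h : Ideal.span {g} = ⊤) : IsUnit g := by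
  obtain ⟨a, ha⟩ := Ideal.mem_span_singleton'.1 (h ▸ Submodule.mem_top : (1 : SkewPoly σ) ∈ _)
  have hne : a * g ≠ 0 := by rw [ha]; exact one_ne_zero
  have := deg_mul (left_ne_zero_of_mul hne) (right_ne_zero_of_mul hne)
  rw [ha, deg_one] at this
  exact (isUnit_iff_deg_eq_zero (right_ne_zero_of_mul hne)).2 (by omega)

/-- A left ideal containing `g` is some `Rh` with `g = k h`; irreducibility makes `k` or `h` a unit.
-/
theorem isSimpleModule_quotient_span {g : SkewPoly σ} (hg : Irreducible g) :
    IsSimpleModule (SkewPoly σ) (SkewPoly σ ⧸ Ideal.span {g}) := by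
  rw [isSimpleModule_iff_isCoatom]
  refine ⟨fun h ↦ hg.not_isUnit (isUnit_of_span_eq_top h), fun J hJ ↦ ?_⟩
  obtain ⟨h, rfl⟩ := exists_eq_span J
  obtain ⟨k, hk⟩ := Ideal.mem_span_singleton'.1 (hJ.le (Ideal.mem_span_singleton_self g))
  rcases hg.isUnit_or_isUnit hk.symm with hu | hu
  · exfalso
    refine hJ.not_ge ?_
    rw [Ideal.span_singleton_le_iff_mem, Ideal.mem_span_singleton']
    obtain ⟨u, hu⟩ := hu.exists_left_inv
    exact ⟨u, by rw [← hk, ← mul_assoc, hu, one_mul]⟩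
  · obtain ⟨u, hu⟩ := hu.exists_left_inv
    rw [Ideal.eq_top_iff_one, Ideal.mem_span_singleton']
    exact ⟨u, hu⟩

/-- `R ⧸ R g` has `|F| ^ deg g` elements. -/
theorem natCard_quotient_span {g : SkewPoly σ} (hg : g ≠ 0) :
    Nat.card (SkewPoly σ ⧸ Ideal.span {g}) = Nat.card F ^ g.deg := by
  let φ : (Fin g.deg → F) → SkewPoly σ := fun a ↦ ∑ i, const σ (a i) * var σ ^ (i : ℕ)
  have hφ : ∀ a k, (φ a).coeff k = if h : k < g.deg then a ⟨k, h⟩ else 0 := by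
    intro a k
    simp only [φ, coeff_sum, coeff_const_mul, coeff_var_pow, mul_ite, mul_one, mul_zero]
    split_ifs with h
    · rw [Finset.sum_eq_single ⟨k, h⟩]
      · simp
      · intro b _ hb
        rw [if_neg]
        rintro rfl
        exact hb rfl
      · simp
    · refine Finset.sum_eq_zero fun i _ ↦ if_neg ?_
      have := i.2
      omega
  have hbij : Function.Bijective
      (fun a ↦ (Submodule.Quotient.mk (φ a) : SkewPoly σ ⧸ Ideal.span {g})) := by
    constructor
    · intro a b hab
      have h0 := eq_zero_of_mem_span_of_coeff_eq_zero ((Submodule.Quotient.eq _).1 hab)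
        (fun k hk ↦ by simp [hφ, not_lt.2 hk])
      funext i
      have := congrArg (coeff · i) (sub_eq_zero.1 h0)
      simpa [hφ] using this
    · intro x
      obtain ⟨y, rfl⟩ := Submodule.Quotient.mk_surjective _ x
      obtain ⟨q, r, rfl, hr⟩ := exists_eq_mul_add hg y
      refine ⟨fun i ↦ r.coeff i, ((Submodule.Quotient.eq _).2 ?_).symm⟩
      have : φ (fun i ↦ r.coeff i) = r := ext_coeff fun k ↦ by
        rw [hφ]
        split_ifs with h
        · rfl
        · exact (hr k (not_lt.1 h)).symm
      rw [this, add_sub_cancel_right]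
      exact Ideal.mem_span_singleton'.2 ⟨q, rfl⟩
  rw [← Nat.card_congr (Equiv.ofBijective _ hbij), Nat.card_fun, Nat.card_fin]

end Degree

end SkewPoly

/-! ### The centre `F^σ[z]` and the fixed field. -/

namespace SkewPoly

section Center

variable {F : Type*} [Field F] {σ : F ≃+* F}

theorem eq_sum_const_mul_var_pow (f : SkewPoly σ) :
    f = ∑ i ∈ Finset.range (f.deg + 1), const σ (f.coeff i) * var σ ^ i := by
  refine ext_coeff fun n ↦ ?_
  simp only [coeff_sum, coeff_const_mul, coeff_var_pow, mul_ite, mul_one, mul_zero,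
    Finset.sum_ite_eq, Finset.mem_range]
  split_ifs with h
  · rfl
  · exact coeff_eq_zero_of_deg_lt (by omega)

/-- An element commuting with the constants and with the variable is central. -/
theorem commute_of_commute_const_of_commute_var {r : SkewPoly σ}
    (hc : ∀ a, Commute r (const σ a)) (hv : Commute r (var σ)) (f : SkewPoly σ) :
    Commute r f := by
  rw [eq_sum_const_mul_var_pow f]
  exact Commute.sum_right _ _ _ fun i _ ↦ (hc _).mul_right (hv.pow_right i)

theorem var_pow_mul_const (m : ℕ) (a : F) :
    var σ ^ m * const σ a = const σ ((σ ^ m) a) * var σ ^ m := by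
  refine ext_coeff fun n ↦ ?_
  rw [coeff_const_mul, coeff_mul_const, coeff_var_pow]
  split_ifs with h
  · subst h; simp
  · simp

theorem commute_var_pow_orderOf_const (a : F) :
    Commute (var σ ^ orderOf (σ : RingAut F)) (const σ a) := by
  have h := var_pow_mul_const (σ := σ) (orderOf (σ : RingAut F)) a
  rw [pow_orderOf_eq_one] at h
  exact h

theorem commute_var_const_of_mem {a : F} (ha : a ∈ fixedField σ) :
    Commute (var σ) (const σ a) := by
  have h := var_mul_const (σ := σ) a
  rwa [show σ a = a from ha] at h

theorem ofFixed_eq_sum (p : Polynomial (fixedField σ)) :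
    ofFixed σ p = ∑ i ∈ Finset.range (p.natDegree + 1),
      const σ (p.coeff i : F) * var σ ^ (orderOf (σ : RingAut F) * i) := by
  rw [ofFixed, Polynomial.eval₂_eq_sum_range]
  simp only [pow_mul]
  rfl

/-- The inclusion `F^σ[z] ⊆ F[X;σ]`, as a ring homomorphism. -/
noncomputable def ofFixedHom (σ : F ≃+* F) : Polynomial (fixedField σ) →+* SkewPoly σ :=
  Polynomial.eval₂RingHom' ((const σ).comp (fixedField σ).subtype)
    (var σ ^ orderOf (σ : RingAut F)) fun a ↦ (commute_var_pow_orderOf_const (a : F)).symm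

theorem ofFixedHom_apply (p : Polynomial (fixedField σ)) : ofFixedHom σ p = ofFixed σ p := rfl

theorem ofFixedHom_C (a : fixedField σ) : ofFixedHom σ (Polynomial.C a) = const σ (a : F) :=
  Polynomial.eval₂_C _ _

theorem ofFixedHom_X : ofFixedHom σ Polynomial.X = var σ ^ orderOf (σ : RingAut F) :=
  Polynomial.eval₂_X _ _

theorem commute_ofFixed (p : Polynomial (fixedField σ)) (f : SkewPoly σ) :
    Commute (ofFixed σ p) f := by
  refine commute_of_commute_const_of_commute_var (fun a ↦ ?_) ?_ f
  · rw [ofFixed_eq_sum]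
    refine Commute.sum_left _ _ _ fun i _ ↦ Commute.mul_left ?_ ?_
    · exact (Commute.all _ _).map (const σ)
    · rw [pow_mul]
      exact (commute_var_pow_orderOf_const a).pow_left i
  · rw [ofFixed_eq_sum]
    exact Commute.sum_left _ _ _ fun i _ ↦
      Commute.mul_left (commute_var_const_of_mem (p.coeff i).2).symm ((Commute.refl _).pow_left _)

theorem coeff_ofFixed_of_not_dvd (p : Polynomial (fixedField σ)) {k : ℕ}
    (hk : ¬ orderOf (σ : RingAut F) ∣ k) : (ofFixed σ p).coeff k = 0 := by
  rw [ofFixed_eq_sum, coeff_sum]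
  refine Finset.sum_eq_zero fun i _ ↦ ?_
  rw [coeff_const_mul, coeff_var_pow, if_neg, mul_zero]
  rintro rfl
  exact hk (dvd_mul_right _ _)

variable [Finite F]

theorem orderOf_pos_of_finite (σ : F ≃+* F) : 0 < orderOf (σ : RingAut F) := by
  have : Finite (RingAut F) := Finite.of_injective (fun τ : F ≃+* F ↦ (τ : F → F))
    DFunLike.coe_injective
  exact orderOf_pos _

theorem coeff_ofFixed_mul (p : Polynomial (fixedField σ)) (k : ℕ) :
    (ofFixed σ p).coeff (orderOf (σ : RingAut F) * k) = p.coeff k := by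
  have hμ := orderOf_pos_of_finite σ
  simp only [ofFixed_eq_sum, coeff_sum, coeff_const_mul, coeff_var_pow,
    Nat.mul_right_inj hμ.ne', mul_ite, mul_one, mul_zero, Finset.sum_ite_eq, Finset.mem_range]
  split_ifs with h
  · rfl
  · rw [Polynomial.coeff_eq_zero_of_natDegree_lt (by omega)]
    rfl

theorem ofFixed_injective : Function.Injective (ofFixed σ) := fun p q h ↦ by
  ext k
  rw [← coeff_ofFixed_mul, h, coeff_ofFixed_mul]

theorem ofFixed_ne_zero {p : Polynomial (fixedField σ)} (hp : p ≠ 0) : ofFixed σ p ≠ 0 :=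
  (map_ne_zero_iff (ofFixedHom σ) ofFixed_injective).2 hp

theorem deg_ofFixed (p : Polynomial (fixedField σ)) :
    (ofFixed σ p).deg = orderOf (σ : RingAut F) * p.natDegree := by
  have hμ := orderOf_pos_of_finite σ
  by_cases hp : p = 0
  · subst hp
    have : ofFixed σ 0 = 0 := map_zero (ofFixedHom σ)
    rw [this, deg_zero, Polynomial.natDegree_zero, mul_zero]
  refine le_antisymm (deg_le_of_coeff_eq_zero fun k hk ↦ ?_) (le_deg_of_coeff_ne_zero ?_)
  · by_cases hd : orderOf (σ : RingAut F) ∣ k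
    · obtain ⟨j, rfl⟩ := hd
      rw [coeff_ofFixed_mul,
        Polynomial.coeff_eq_zero_of_natDegree_lt (Nat.lt_of_mul_lt_mul_left hk)]
      rfl
    · exact coeff_ofFixed_of_not_dvd p hd
  · rw [coeff_ofFixed_mul, Polynomial.coeff_natDegree]
    simpa using hp

/-- The centre of `F[X;σ]` is `F^σ[z]`. -/
theorem exists_eq_ofFixed {r : SkewPoly σ} (hc : ∀ a, Commute r (const σ a))
    (hv : Commute r (var σ)) : ∃ p, r = ofFixed σ p := by
  have hμ := orderOf_pos_of_finite σ
  have hfix : ∀ k, r.coeff k ∈ fixedField σ := fun k ↦ by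
    have := congrArg (coeff · (k + 1)) hv.eq
    simp only [coeff_mul_var_succ, coeff_var_mul_succ] at this
    exact this.symm
  -- Commuting with `a` gives `r_k σ^k(a) = a r_k`, so `σ^k = 1` whenever `r_k ≠ 0`.
  have hdvd : ∀ k, r.coeff k ≠ 0 → orderOf (σ : RingAut F) ∣ k := fun k hk ↦ by
    refine orderOf_dvd_of_pow_eq_one (RingEquiv.ext fun a ↦ ?_)
    have := congrArg (coeff · k) (hc a).eq
    simp only [coeff_mul_const, coeff_const_mul] at this
    rw [mul_comm] at this
    exact mul_right_cancel₀ hk this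
  let p : Polynomial (fixedField σ) := ∑ j ∈ Finset.range (r.deg + 1),
    Polynomial.monomial j ⟨r.coeff (orderOf (σ : RingAut F) * j), hfix _⟩
  have hp : ∀ j, (p.coeff j : F) = r.coeff (orderOf (σ : RingAut F) * j) := fun j ↦ by
    simp only [p, Polynomial.finsetSum_coeff, Polynomial.coeff_monomial, Finset.sum_ite_eq',
      Finset.mem_range]
    split_ifs with h
    · rfl
    · rw [coeff_eq_zero_of_deg_lt]
      · rfl
      · nlinarith
  refine ⟨p, ext_coeff fun k ↦ ?_⟩
  by_cases hd : orderOf (σ : RingAut F) ∣ k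
  · obtain ⟨j, rfl⟩ := hd
    rw [coeff_ofFixed_mul, hp]
  · rw [coeff_ofFixed_of_not_dvd p hd]
    exact not_not.1 (mt (hdvd k) hd)

/-- Artin's theorem for the cyclic group generated by `σ`: the degree of `F` over its fixed field is
`μ`. -/
theorem natCard_eq_natCard_fixedField_pow (σ : F ≃+* F) :
    Nat.card F = Nat.card (fixedField σ) ^ orderOf (σ : RingAut F) := by
  let G := Subgroup.zpowers (σ : RingAut F)
  have : Finite (RingAut F) := Finite.of_injective (fun τ : F ≃+* F ↦ (τ : F → F))
    DFunLike.coe_injective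
  have : Fintype G := Fintype.ofFinite G
  have hfield : FixedPoints.subfield G F = fixedField σ := by
    ext x
    constructor
    · intro h
      exact h ⟨σ, Subgroup.mem_zpowers _⟩
    · rintro h ⟨τ, hτ⟩
      obtain ⟨k, rfl⟩ := Subgroup.mem_zpowers_iff.1 hτ
      have hs : (σ : RingAut F) ∈ MulAction.stabilizer (RingAut F) x := h
      exact Subgroup.zpow_mem _ hs k
  have hrank := FixedPoints.finrank_eq_card G F
  rw [← Nat.card_eq_fintype_card, Nat.card_zpowers] at hrank
  have h := Module.natCard_eq_pow_finrank (K := FixedPoints.subfield G F) (V := F)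
  rw [hrank] at h
  rwa [hfield] at h

end Center

end SkewPoly

/-! ### Two-sided ideals and central elements modulo `p`. -/

namespace SkewPoly

section CentralQuotient

variable {F : Type*} [Field F] {σ : F ≃+* F}

/-- For `n > 0` the coefficient is `σ(r_{n-1}) - r_{n-1}`. If `r_{n-1} ≠ 0`, the hypothesis in
degree `n-1` gives `σ^{n-1} = σ^n`, so `σ` is the identity. This handles the one coefficient that
degree bounds leave open. -/
theorem coeff_var_mul_sub_mul_var {r : SkewPoly σ} {n : ℕ}
    (hr : ∀ a, r * const σ a = const σ ((σ ^ n) a) * r) :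
    (var σ * r - r * var σ).coeff n = 0 := by
  cases n with
  | zero => simp
  | succ n =>
    have hn : ∀ a, r.coeff n * (σ ^ n) a = (σ ^ (n + 1)) a * r.coeff n := fun a ↦ by
      simpa using congrArg (coeff · n) (hr a)
    rw [coeff_sub, coeff_var_mul_succ, coeff_mul_var_succ, sub_eq_zero]
    by_cases h0 : r.coeff n = 0
    · rw [h0, map_zero]
    · have hσ : ∀ a, σ ((σ ^ n) a) = (σ ^ n) a := fun a ↦ by
        have h := hn a
        rw [mul_comm] at h
        have h' := mul_right_cancel₀ h0 h
        rw [pow_succ'] at h'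
        exact h'.symm
      obtain ⟨a, ha⟩ := (σ ^ n).surjective (r.coeff n)
      rw [← ha, hσ]

theorem mul_mem_span_ofFixed {p : Polynomial (fixedField σ)} {u : SkewPoly σ}
    (hu : u ∈ Ideal.span {ofFixed σ p}) (v : SkewPoly σ) :
    u * v ∈ Ideal.span {ofFixed σ p} := by
  obtain ⟨q, rfl⟩ := Ideal.mem_span_singleton'.1 hu
  rw [mul_assoc, (commute_ofFixed p v).eq, ← mul_assoc]
  exact Ideal.mem_span_singleton'.2 ⟨_, rfl⟩

/-- Modulo `p` the variable is invertible: `p = X h + p(0)` with `p(0)` a nonzero constant. -/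
theorem mem_span_ofFixed_of_mul_var_mem {p : Polynomial (fixedField σ)} (hp : p.coeff 0 ≠ 0)
    {w : SkewPoly σ} (hw : w * var σ ∈ Ideal.span {ofFixed σ p})
    (hμ : 0 < orderOf (σ : RingAut F)) :
    w ∈ Ideal.span {ofFixed σ p} := by
  have hdecomp : ofFixed σ p = var σ * (var σ ^ (orderOf (σ : RingAut F) - 1) *
      ofFixed σ p.divX) + const σ (p.coeff 0 : F) := by
    rw [← mul_assoc, ← pow_succ', Nat.sub_add_cancel hμ, ← ofFixedHom_X, ← ofFixedHom_C,
      ← ofFixedHom_apply, ← ofFixedHom_apply, ← map_mul, ← map_add, mul_comm,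
      Polynomial.divX_mul_X_add]
  have h1 : w * ofFixed σ p ∈ Ideal.span {ofFixed σ p} := Ideal.mem_span_singleton'.2 ⟨w, rfl⟩
  have h2 : w * const σ (p.coeff 0 : F) ∈ Ideal.span {ofFixed σ p} := by
    have := Ideal.sub_mem _ h1 (mul_mem_span_ofFixed hw
      (var σ ^ (orderOf (σ : RingAut F) - 1) * ofFixed σ p.divX))
    convert this using 1
    rw [hdecomp, mul_add, ← mul_assoc, add_sub_cancel_left]
  have h3 := mul_mem_span_ofFixed h2 (const σ (p.coeff 0 : F)⁻¹)
  have h0 : (p.coeff 0 : F) ≠ 0 := by simpa using hp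
  rwa [mul_assoc, ← map_mul, mul_inv_cancel₀ h0, map_one, mul_one] at h3

variable [Finite F]

/-- The ideal generated by an irreducible `p ∈ F^σ[z]` with `p(0) ≠ 0` is a maximal two-sided
ideal. -/
theorem eq_span_ofFixed_of_isTwoSided {p : Polynomial (fixedField σ)} (hp : Irreducible p)
    (hp0 : p.coeff 0 ≠ 0) {I : Ideal (SkewPoly σ)} [I.IsTwoSided] (hI : I ≠ ⊤)
    (hpI : ofFixed σ p ∈ I) : I = Ideal.span {ofFixed σ p} := by
  have hμ := orderOf_pos_of_finite σ
  have hIbot : I ≠ ⊥ := fun h ↦ ofFixed_ne_zero hp.ne_zero (by simpa [h] using hpI)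
  obtain ⟨g₀, hg₀I, hg₀, hmin⟩ := exists_min_deg hIbot
  set n := g₀.deg with hn
  obtain ⟨g, hgI, hg1, hgI', hgn⟩ : ∃ g ∈ I, g.coeff n = 1 ∧ I = Ideal.span {g} ∧
      g.deg = n := by
    have hc := coeff_deg_ne_zero hg₀
    have hne := const_ne_zero (σ := σ) (inv_ne_zero hc)
    have hd : (const σ (g₀.coeff g₀.deg)⁻¹ * g₀).deg = n := by
      rw [deg_mul hne hg₀, deg_const, zero_add]
    have hmem := I.mul_mem_left (const σ (g₀.coeff g₀.deg)⁻¹) hg₀I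
    exact ⟨_, hmem, by rw [coeff_const_mul, ← hn, inv_mul_cancel₀ hc],
      eq_span_of_deg_le hmem (mul_ne_zero hne hg₀) (by rwa [hd]), hd⟩
  have hzero : ∀ h ∈ I, (∀ k, n ≤ k → h.coeff k = 0) → h = 0 := fun h hh hk ↦
    eq_zero_of_mem_span_of_coeff_eq_zero (g := g) (hgI' ▸ hh) (by rwa [hgn])
  have hgt : ∀ k, n < k → g.coeff k = 0 := fun k hk ↦ coeff_eq_zero_of_deg_lt (by omega)
  -- The difference lies in `I` and, `g` being monic, has degree below the minimum `n`, hence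
  -- vanishes.
  have hgc : ∀ a, g * const σ a = const σ ((σ ^ n) a) * g := fun a ↦ by
    refine sub_eq_zero.1 (hzero _ (I.sub_mem (I.mul_mem_right _ hgI) (I.mul_mem_left _ hgI))
      fun k hk ↦ ?_)
    rcases hk.eq_or_lt with rfl | hk
    · simp [hg1]
    · simp [hgt k hk]
  have hgv : Commute g (var σ) := by
    refine (sub_eq_zero.1 (hzero _ (I.sub_mem (I.mul_mem_left _ hgI) (I.mul_mem_right _ hgI))
      fun k hk ↦ ?_)).symm
    rcases hk.eq_or_lt with rfl | hk
    · exact coeff_var_mul_sub_mul_var hgc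
    · obtain ⟨j, rfl⟩ := Nat.exists_eq_add_of_lt hk
      rw [coeff_sub, coeff_var_mul_succ, coeff_mul_var_succ]
      rcases Nat.eq_zero_or_pos j with rfl | hj
      · simp [hg1]
      · simp [hgt (n + j) (by omega)]
  -- `g` twists constants by `σ^n`. This `m` makes `n + m` a multiple of `μ`, so `g X^m` is central.
  set m := n * (orderOf (σ : RingAut F) - 1) with hm
  have hnm : n + m = orderOf (σ : RingAut F) * n := by
    obtain ⟨k, hk⟩ := Nat.exists_eq_add_of_lt hμ
    rw [hm, hk]
    simp only [zero_add, Nat.add_sub_cancel]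
    ring
  obtain ⟨c, hc⟩ : ∃ c, g * var σ ^ m = ofFixed σ c := by
    refine exists_eq_ofFixed (fun a ↦ ?_) (hgv.mul_left ((Commute.refl _).pow_left _))
    change g * var σ ^ m * const σ a = const σ a * (g * var σ ^ m)
    rw [mul_assoc, var_pow_mul_const, ← mul_assoc, hgc, ← RingAut.mul_apply, ← pow_add, hnm,
      pow_mul, pow_orderOf_eq_one, one_pow, mul_assoc]
    rfl
  have hcI : ofFixed σ c ∈ I := hc ▸ I.mul_mem_right _ hgI
  by_cases hdvd : p ∣ c
  · obtain ⟨d, rfl⟩ := hdvd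
    have hmem : g * var σ ^ m ∈ Ideal.span {ofFixed σ p} := by
      rw [hc, mul_comm]
      exact Ideal.mem_span_singleton'.2 ⟨ofFixed σ d, (map_mul (ofFixedHom σ) d p).symm⟩
    -- With `m` arbitrary, induction cancels the powers of `X` one at a time.
    clear_value m
    clear hm hnm hc hcI
    have hgmem : g ∈ Ideal.span {ofFixed σ p} := by
      induction m with
      | zero => simpa using hmem
      | succ m ih =>
        refine ih (mem_span_ofFixed_of_mul_var_mem hp0 ?_ hμ)
        rwa [mul_assoc, ← pow_succ]
    refine le_antisymm ?_ ((Ideal.span_singleton_le_iff_mem I).2 hpI)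
    rw [hgI']
    exact (Ideal.span_singleton_le_iff_mem _).2 hgmem
  · exfalso
    obtain ⟨a, b, hab⟩ := hp.coprime_iff_not_dvd.2 hdvd
    refine hI ((Ideal.eq_top_iff_one I).2 ?_)
    have h1 := congrArg (ofFixedHom σ) hab
    rw [map_add, map_mul, map_mul, map_one] at h1
    rw [← h1]
    exact I.add_mem (I.mul_mem_left _ hpI) (I.mul_mem_left _ hcI)

/-- Modulo the ideal generated by a nonzero `p ∈ F^σ[z]`, every central element is represented
by an element of `F^σ[z]`. -/
theorem exists_sub_ofFixed_mem_span {p : Polynomial (fixedField σ)} (hp : p ≠ 0)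
    {r : SkewPoly σ} (hr : ∀ a, r * a - a * r ∈ Ideal.span {ofFixed σ p}) :
    ∃ c, r - ofFixed σ c ∈ Ideal.span {ofFixed σ p} := by
  obtain ⟨q, s, rfl, hs⟩ := exists_eq_mul_add (ofFixed_ne_zero hp) r
  have hq : q * ofFixed σ p ∈ Ideal.span {ofFixed σ p} := Ideal.mem_span_singleton'.2 ⟨q, rfl⟩
  have hs' : ∀ a, s * a - a * s ∈ Ideal.span {ofFixed σ p} := fun a ↦ by
    have := Ideal.sub_mem _ (hr a) (Ideal.sub_mem _ (mul_mem_span_ofFixed hq a)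
      (Ideal.mul_mem_left _ a hq))
    convert this using 1
    noncomm_ring
  have hsc : ∀ a, Commute s (const σ a) := fun a ↦
    sub_eq_zero.1 (eq_zero_of_mem_span_of_coeff_eq_zero (hs' _) fun k hk ↦ by simp [hs k hk])
  have hsv : Commute s (var σ) := by
    refine sub_eq_zero.1 (eq_zero_of_mem_span_of_coeff_eq_zero (hs' _) fun k hk ↦ ?_)
    rcases hk.eq_or_lt with rfl | hk
    · rw [← neg_sub, coeff_neg, coeff_var_mul_sub_mul_var, neg_zero]
      intro a
      rw [deg_ofFixed, pow_mul, pow_orderOf_eq_one, one_pow]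
      exact hsc a
    · obtain ⟨j, rfl⟩ := Nat.exists_eq_add_of_lt hk
      rw [coeff_sub, coeff_var_mul_succ, coeff_mul_var_succ, hs _ (by omega), map_zero, sub_zero]
  obtain ⟨c, rfl⟩ := exists_eq_ofFixed hsc hsv
  exact ⟨c, by rwa [add_sub_cancel_right]⟩

end CentralQuotient

end SkewPoly

/-! ### Density for finite simple modules. -/

section FiniteSimpleModule

theorem finite_moduleEnd (R M : Type*) [Ring R] [AddCommGroup M] [Module R M] [Finite M] :
    Finite (Module.End R M) :=
  Finite.of_injective (fun f : Module.End R M ↦ (f : M → M)) DFunLike.coe_injective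

variable (R M : Type*) [Ring R] [AddCommGroup M] [Module R M] [IsSimpleModule R M] [Finite M]

/-- Schur's lemma together with Wedderburn's little theorem. -/
theorem moduleEnd_mul_comm (e e' : Module.End R M) : e * e' = e' * e := by
  classical
  have := finite_moduleEnd R M
  exact (littleWedderburn (Module.End R M)).mul_comm e e'

/-- Every endomorphism of a finite simple module is given by the action of a ring element. -/
theorem exists_smul_eq_of_moduleEnd (e : Module.End R M) : ∃ r : R, ∀ m, e m = r • m := by
  have : Module.Finite (Module.End R M) M := Module.Finite.of_finite
  -- As `E` is commutative, `e` is itself `E`-linear, so density applies to it.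
  let f : Module.End (Module.End R M) M :=
    { toFun := e
      map_add' := e.map_add
      map_smul' := fun e' m ↦ congrArg (fun g : Module.End R M ↦ g m)
        (moduleEnd_mul_comm R M e e') }
  obtain ⟨r, hr⟩ := Module.Finite.toModuleEnd_moduleEnd_surjective (R := R) f
  exact ⟨r, fun m ↦ (congrArg (fun g : Module.End (Module.End R M) M ↦ g m) hr).symm⟩

/-- A finite simple module with `|E| ^ n` elements, where `E` is its endomorphism ring, has
`|M| ^ n` ring elements acting differently on it. -/
theorem exists_natCard_eq_pow : ∃ n : ℕ, Nat.card M = Nat.card (Module.End R M) ^ n ∧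
    Nat.card (R ⧸ Module.annihilator R M) = Nat.card M ^ n := by
  classical
  have : Module.Finite (Module.End R M) M := Module.Finite.of_finite
  refine ⟨Module.finrank (Module.End R M) M, Module.natCard_eq_pow_finrank, ?_⟩
  have hsurj := Module.Finite.toModuleEnd_moduleEnd_surjective (R := R) (M := M)
  have hker : RingHom.ker (Module.toModuleEnd (Module.End R M) (S := R) M) =
      Module.annihilator R M := by
    ext r
    rw [RingHom.mem_ker, Module.mem_annihilator]
    exact LinearMap.ext_iff
  -- An `E`-linear endomorphism is a free choice of images for the `n` basis vectors, so there are
  -- `|M|^n`.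
  rw [← hker, Nat.card_congr (RingHom.quotientKerEquivOfSurjective hsurj).toEquiv,
    Nat.card_congr ((Module.finBasis (Module.End R M) M).constr ℕ (M' := M)).toEquiv.symm,
    Nat.card_fun, Nat.card_fin]

end FiniteSimpleModule

/-! ### Simple quotients annihilated by `p`. -/

namespace SkewPoly

section SimpleQuotient

variable {F : Type*} [Field F] {σ : F ≃+* F} [Finite F]

/-- The annihilator is two-sided, contains the central `p`, and is proper since `1 ∉ Rg`; maximality
of `Rp` does the rest. -/
theorem annihilator_quotient_span {p : Polynomial (fixedField σ)} (hp : Irreducible p)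
    (hp0 : p.coeff 0 ≠ 0) {g : SkewPoly σ} (hg : ¬ IsUnit g)
    (hpg : ofFixed σ p ∈ Ideal.span {g}) :
    Module.annihilator (SkewPoly σ) (SkewPoly σ ⧸ Ideal.span {g}) =
      Ideal.span {ofFixed σ p} := by
  refine eq_span_ofFixed_of_isTwoSided hp hp0 (fun h ↦ hg (isUnit_of_span_eq_top ?_)) ?_
  · rw [Ideal.eq_top_iff_one]
    have h1 : (1 : SkewPoly σ) ∈
        Module.annihilator (SkewPoly σ) (SkewPoly σ ⧸ Ideal.span {g}) := h ▸ Submodule.mem_top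
    have := Module.mem_annihilator.1 h1 (Submodule.Quotient.mk 1)
    rwa [one_smul, Submodule.Quotient.mk_eq_zero] at this
  · refine Module.mem_annihilator.2 fun m ↦ ?_
    obtain ⟨r, rfl⟩ := Submodule.Quotient.mk_surjective _ m
    rw [← Submodule.Quotient.mk_smul, Submodule.Quotient.mk_eq_zero, smul_eq_mul,
      (commute_ofFixed p r).eq]
    exact Ideal.mul_mem_left _ r hpg

/-- The endomorphism ring of `R ⧸ R g`, where the irreducible `g` divides the irreducible
`p ∈ F^σ[z]`, has as many elements as the field `F^σ[z] ⧸ (p)`. -/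
theorem natCard_moduleEnd_quotient_span {p : Polynomial (fixedField σ)} (hp : Irreducible p)
    (hp0 : p.coeff 0 ≠ 0) {g : SkewPoly σ} (hg : Irreducible g)
    (hpg : ofFixed σ p ∈ Ideal.span {g}) :
    Nat.card (Module.End (SkewPoly σ) (SkewPoly σ ⧸ Ideal.span {g})) =
      Nat.card (fixedField σ) ^ p.natDegree := by
  have hann := annihilator_quotient_span hp hp0 hg.not_isUnit hpg
  have := isSimpleModule_quotient_span hg
  have : Finite (SkewPoly σ ⧸ Ideal.span {g}) := Nat.finite_of_card_ne_zero (by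
    rw [natCard_quotient_span hg.ne_zero]
    exact pow_ne_zero _ Nat.card_pos.ne')
  let ψ : Polynomial (fixedField σ) →+*
      Module.End (SkewPoly σ) (SkewPoly σ ⧸ Ideal.span {g}) :=
    { toFun := fun c ↦
        { toFun := fun m ↦ ofFixed σ c • m
          map_add' := smul_add _
          map_smul' := fun r m ↦ by
            rw [smul_smul, (commute_ofFixed c r).eq, mul_smul, RingHom.id_apply] }
      map_one' := LinearMap.ext fun m ↦ by
        change ofFixedHom σ 1 • m = m
        rw [map_one, one_smul]
      map_zero' := LinearMap.ext fun m ↦ by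
        change ofFixedHom σ 0 • m = 0
        rw [map_zero, zero_smul]
      map_add' := fun a b ↦ LinearMap.ext fun m ↦ by
        change ofFixedHom σ (a + b) • m = ofFixedHom σ a • m + ofFixedHom σ b • m
        rw [map_add, add_smul]
      map_mul' := fun a b ↦ LinearMap.ext fun m ↦ by
        change ofFixedHom σ (a * b) • m = ofFixedHom σ a • ofFixedHom σ b • m
        rw [map_mul, mul_smul] }
  have hψ : ∀ c m, ψ c m = ofFixed σ c • m := fun _ _ ↦ rfl
  -- An endomorphism acts as some `r ∈ R`. Being `R`-linear, it makes `r` central modulo the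
  -- annihilator `Rp`, so `r` is represented in `F^σ[z]`.
  have hsurj : Function.Surjective ψ := fun e ↦ by
    obtain ⟨r, hr⟩ := exists_smul_eq_of_moduleEnd _ _ e
    obtain ⟨c, hc⟩ := exists_sub_ofFixed_mem_span (p := p) hp.ne_zero (r := r) fun a ↦ by
      rw [← hann, Module.mem_annihilator]
      intro m
      rw [sub_smul, mul_smul, mul_smul, ← hr, ← hr, map_smul, sub_self]
    rw [← hann, Module.mem_annihilator] at hc
    refine ⟨c, LinearMap.ext fun m ↦ ?_⟩
    rw [hψ, hr]
    have := hc m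
    rw [sub_smul, sub_eq_zero] at this
    exact this.symm
  have hker : RingHom.ker ψ = Ideal.span {p} := by
    have hmax : (Ideal.span {p}).IsMaximal := PrincipalIdealRing.isMaximal_of_irreducible hp
    have : Nontrivial (SkewPoly σ ⧸ Ideal.span {g}) :=
      IsSimpleModule.nontrivial (SkewPoly σ) _
    refine (hmax.eq_of_le (RingHom.ker_ne_top ψ) ?_).symm
    rw [Ideal.span_singleton_le_iff_mem, RingHom.mem_ker]
    have hmem : ofFixed σ p ∈
        Module.annihilator (SkewPoly σ) (SkewPoly σ ⧸ Ideal.span {g}) :=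
      hann ▸ Ideal.mem_span_singleton_self _
    exact LinearMap.ext (Module.mem_annihilator.1 hmem)
  rw [← Nat.card_congr (RingHom.quotientKerEquivOfSurjective hsurj).toEquiv, hker]
  change Nat.card (AdjoinRoot p) = _
  have : Module.Finite (fixedField σ) (AdjoinRoot p) := (AdjoinRoot.powerBasis hp.ne_zero).finite
  rw [Module.natCard_eq_pow_finrank (K := fixedField σ),
    (AdjoinRoot.powerBasis hp.ne_zero).finrank, AdjoinRoot.powerBasis_dim]

/-- An irreducible right divisor of an irreducible `p ∈ F^σ[z]` with `p(0) ≠ 0` has the same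
degree as `p`. -/
theorem deg_eq_natDegree_of_mem_span {p : Polynomial (fixedField σ)} (hp : Irreducible p)
    (hp0 : p.coeff 0 ≠ 0) {g : SkewPoly σ} (hg : Irreducible g)
    (hpg : ofFixed σ p ∈ Ideal.span {g}) : g.deg = p.natDegree := by
  have hann := annihilator_quotient_span hp hp0 hg.not_isUnit hpg
  have hE := natCard_moduleEnd_quotient_span hp hp0 hg hpg
  have hM := natCard_quotient_span hg.ne_zero
  have hμ := orderOf_pos_of_finite σ
  have := isSimpleModule_quotient_span hg
  have : Finite (SkewPoly σ ⧸ Ideal.span {g}) := Nat.finite_of_card_ne_zero (by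
    rw [hM]
    exact pow_ne_zero _ Nat.card_pos.ne')
  obtain ⟨n, h1, h2⟩ := exists_natCard_eq_pow (SkewPoly σ) (SkewPoly σ ⧸ Ideal.span {g})
  rw [hann, natCard_quotient_span (ofFixed_ne_zero hp.ne_zero), deg_ofFixed, hM, ← pow_mul] at h2
  rw [hM, hE, natCard_eq_natCard_fixedField_pow σ, ← pow_mul, ← pow_mul] at h1
  have e1 := Nat.pow_right_injective (Finite.one_lt_card (α := fixedField σ)) h1
  have e2 := Nat.pow_right_injective (Finite.one_lt_card (α := F)) h2
  -- Eliminating `n` between `e1` and `e2`.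
  have e3 : orderOf (σ : RingAut F) * (g.deg * g.deg) =
      orderOf (σ : RingAut F) * (p.natDegree * p.natDegree) := by
    calc orderOf (σ : RingAut F) * (g.deg * g.deg)
        = orderOf (σ : RingAut F) * g.deg * g.deg := (mul_assoc _ _ _).symm
      _ = p.natDegree * n * g.deg := by rw [e1]
      _ = p.natDegree * (g.deg * n) := by ring
      _ = p.natDegree * (orderOf (σ : RingAut F) * p.natDegree) := by rw [e2]
      _ = _ := by ring
  exact Nat.mul_self_inj.1 (Nat.eq_of_mul_eq_mul_left hμ e3)

end SimpleQuotient

end SkewPoly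

/-! ### Factors of `f` and the degree count. -/

namespace SkewPoly

section Factorization

variable {F : Type*} [Field F] {σ : F ≃+* F}

/-- A skew polynomial coprime to `X` and dividing a power of `X` on the right is a unit. -/
theorem isUnit_of_var_pow_mem_span {f : SkewPoly σ} (hX : IsRightGCD f (var σ) 1) {n : ℕ}
    (hn : var σ ^ n ∈ Ideal.span {f}) : IsUnit f := by
  have h1 : (1 : SkewPoly σ) ∈ Ideal.span {f} ⊔ Ideal.span {var σ} := by
    rw [hX]
    exact Ideal.mem_span_singleton_self _
  obtain ⟨y, hy, z, hz, hyz⟩ := Submodule.mem_sup.1 h1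
  obtain ⟨a, rfl⟩ := Ideal.mem_span_singleton'.1 hy
  obtain ⟨b, rfl⟩ := Ideal.mem_span_singleton'.1 hz
  -- Compare constant terms in `a f + b X = 1`.
  have hf0 : f.coeff 0 ≠ 0 := by
    intro h
    simpa [coeff_mul_zero, h, coeff_one, coeff_var] using congrArg (coeff · 0) hyz
  induction n with
  | zero => exact isUnit_of_span_eq_top ((Ideal.eq_top_iff_one _).2 (by simpa using hn))
  | succ n ih =>
    obtain ⟨h, hh⟩ := Ideal.mem_span_singleton'.1 hn
    have h0 : h.coeff 0 = 0 := by
      have := congrArg (coeff · 0) hh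
      simp only [coeff_mul_zero, coeff_var_pow] at this
      simpa [hf0] using this
    -- Pulling `X` out on the left untwists coefficients, hence `σ.symm`; cancelling it leaves `k f
    -- = X^n`.
    obtain ⟨k, rfl⟩ : ∃ k, h = var σ * k := by
      refine ⟨∑ i ∈ Finset.range h.deg, const σ (σ.symm (h.coeff (i + 1))) * var σ ^ i,
        ext_coeff fun j ↦ ?_⟩
      cases j with
      | zero => simp [h0]
      | succ j =>
        simp only [coeff_var_mul_succ, coeff_sum, coeff_const_mul, coeff_var_pow, mul_ite,
          mul_one, mul_zero, Finset.sum_ite_eq, Finset.mem_range]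
        split_ifs with hj
        · simp
        · rw [map_zero, coeff_eq_zero_of_deg_lt (by omega)]
    refine ih (Ideal.mem_span_singleton'.2 ⟨k, ?_⟩)
    rw [mul_assoc, pow_succ'] at hh
    exact mul_left_cancel₀ var_ne_zero hh

/-- If `p ∈ F^σ[z]` lies in `R f`, it lies in `R q` for every factor `q` of `f`. -/
theorem ofFixed_mem_span_of_mem_span_mul {p : Polynomial (fixedField σ)} {u q v : SkewPoly σ}
    (hv : v ≠ 0) (h : ofFixed σ p ∈ Ideal.span {u * q * v}) : ofFixed σ p ∈ Ideal.span {q} := by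
  obtain ⟨a, ha⟩ := Ideal.mem_span_singleton'.1 h
  -- From `p = a u q v` and `p v = v p`, cancelling `v` on the right gives `p = v a u q`.
  refine Ideal.mem_span_singleton'.2 ⟨v * (a * u), mul_right_cancel₀ hv ?_⟩
  rw [(commute_ofFixed p v).eq, ← ha]
  simp only [mul_assoc]

theorem deg_list_prod_of_forall_deg_eq {l : List (SkewPoly σ)} {d : ℕ}
    (h : ∀ q ∈ l, q ≠ 0 ∧ q.deg = d) : l.prod.deg = l.length * d := by
  induction l with
  | nil => simp [deg_one]
  | cons q l ih =>
    have hl : l.prod ≠ 0 := List.prod_ne_zero fun h0 ↦ (h 0 (List.mem_cons_of_mem _ h0)).1 rfl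
    rw [List.prod_cons, deg_mul (h q List.mem_cons_self).1 hl, (h q List.mem_cons_self).2,
      ih fun r hr ↦ h r (List.mem_cons_of_mem _ hr), List.length_cons]
    ring

end Factorization

end SkewPoly

theorem corollary5p3 {F : Type*} [Field F] [Finite F] (σ : F ≃+* F)
    (f fstar : SkewPoly σ) (hX : IsRightGCD f (SkewPoly.var σ) 1)
    (hbound : IsBound f fstar)
    (hirr : ∃ p : Polynomial (SkewPoly.fixedField σ),
      Irreducible p ∧ fstar = SkewPoly.ofFixed σ p) :
    (∃ l : List (SkewPoly σ), IsIrreducibleFactorization f l) ∧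
      ∀ l : List (SkewPoly σ), IsIrreducibleFactorization f l →
        0 < l.length ∧
        (fstar.deg : ℚ) =
          (orderOf (σ : RingAut F) : ℚ) * (f.deg : ℚ) / (l.length : ℚ) := by

  obtain ⟨p, hp, rfl⟩ := hirr
  have hpf : SkewPoly.ofFixed σ p ∈ Ideal.span {f} :=
    hbound.2.1.2 (Ideal.mem_span_singleton_self _)
  have hb0 := SkewPoly.ofFixed_ne_zero hp.ne_zero
  have hμ := SkewPoly.orderOf_pos_of_finite σ
  have hf0 : f ≠ 0 := by
    rintro rfl
    exact hb0 (by simpa using hpf)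
  -- For a unit `f` the largest two-sided ideal in `Rf` is `R`, which would make `p` a unit despite
  -- its positive degree.
  have hfu : ¬ IsUnit f := by
    intro hu
    have htop : Ideal.span {f} = ⊤ := by
      obtain ⟨v, hv⟩ := hu.exists_left_inv
      exact (Ideal.eq_top_iff_one _).2 (Ideal.mem_span_singleton'.2 ⟨v, hv⟩)
    have hle : (⊤ : Ideal (SkewPoly σ)) ≤ Ideal.span {SkewPoly.ofFixed σ p} :=
      hbound.2.2 ⟨inferInstance, htop.ge⟩
    have hdeg := (SkewPoly.isUnit_iff_deg_eq_zero hb0).1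
      (SkewPoly.isUnit_of_span_eq_top (top_le_iff.1 hle))
    rw [SkewPoly.deg_ofFixed] at hdeg
    exact (Nat.mul_pos hμ hp.natDegree_pos).ne' hdeg
  have hp0 : p.coeff 0 ≠ 0 := by
    intro h0
    obtain ⟨u, hu⟩ :=
      Polynomial.irreducible_X.associated_of_dvd hp (Polynomial.X_dvd_iff.2 h0) |>.symm
    refine hfu (SkewPoly.isUnit_of_var_pow_mem_span hX (n := orderOf (σ : RingAut F)) ?_)
    rw [← SkewPoly.ofFixedHom_X, ← hu, mul_comm, map_mul]
    exact Ideal.mul_mem_left _ _ hpf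
  refine ⟨SkewPoly.exists_irreducible_factorization hf0 hfu, ?_⟩
  rintro l ⟨rfl, hl⟩
  have hlen : 0 < l.length := by
    rw [List.length_pos_iff]
    rintro rfl
    exact hfu (by simp)
  refine ⟨hlen, ?_⟩
  have hdeg : ∀ q ∈ l, q ≠ 0 ∧ q.deg = p.natDegree := by
    intro q hq
    refine ⟨(hl q hq).ne_zero, SkewPoly.deg_eq_natDegree_of_mem_span hp hp0 (hl q hq) ?_⟩
    obtain ⟨l₁, l₂, rfl⟩ := List.append_of_mem hq
    rw [List.prod_append, List.prod_cons, ← mul_assoc] at hpf hf0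
    exact SkewPoly.ofFixed_mem_span_of_mem_span_mul (right_ne_zero_of_mul hf0) hpf
  rw [SkewPoly.deg_list_prod_of_forall_deg_eq hdeg, SkewPoly.deg_ofFixed]
  have hlen' : (l.length : ℚ) ≠ 0 := Nat.cast_ne_zero.2 hlen.ne'
  push_cast
  field_simp
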